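/- \textbf{Theorem (biregular normalization).} Conventions. A real algebraic set $X\subset\mathbb R^n$ is the set of common real zeros of an ideal of $\mathbb R[x_1,\dots,x_n]$ (not necessarily irreducible). $\mathrm{Pol}(X)$ is its ring of polynomial functions; $\mathcal O(X)$ is its ring of regular functions, i.e. the functions $p/q$ on $X$ with $p,q$ polynomials and $q$ nowhere zero on $X$ (the same definition is used on Zariski open subsets of $X$); $\mathcal K(X)$ is the total ring of fractions of $\mathrm{Pol}(X)$. A map between such sets is polynomial (resp. regular) if its coordinate functions are; a biregular isomorphism is a regular bijection with regular inverse. A polynomial map $\varphi:X\to Y$ is finite if $f\mapsto f\circ\varphi$ makes $\mathrm{Pol}(X)$ a finitely generated $\mathrm{Pol}(Y)$-module, and birational if it induces a biregular isomorphism between Zariski dense, Zariski open subsets of $X$ and $Y$. Let $X$ be a real algebraic set. There are real algebraic sets $X'$ (the normalization of $X$) and $X^b$ (the biregular normalization of $X$), with polynomial maps $\pi':X'\to X$ and $\pi^b:X^b\to X$, such that $\mathrm{Pol}(X)\to\mathrm{Pol}(X')$ is the inclusion of $\mathrm{Pol}(X)$ in its integral closure in $\mathcal K(X)$ and $\mathrm{Pol}(X)\to\mathrm{Pol}(X^b)$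 is the inclusion of $\mathrm{Pol}(X)$ in its integral closure in $\mathcal O(X)$. For any such $(X',\pi')$ and $(X^b,\pi^b)$: (1) $\pi^b$ is finite and birational, and it is a biregular isomorphism. (2) For every real algebraic set $Y$ and every finite birational polynomial map $\pi:Y\to X$, the map $\pi$ is a biregular isomorphism if and only if there is a finite birational polynomial map $\theta:X^b\to Y$ with $\pi\circ\theta=\pi^b$. (3) Call a real algebraic set $Y$ with polynomial maps $X'\to Y\to X$ of composite $\pi'$ intermediate between $X$ and $X'$ if both induced homomorphisms $\mathrm{Pol}(X)\to\mathrm{Pol}(Y)\to\mathrm{Pol}(X')$ are injective. Then there is a finite birational polynomial map $X'\to X^b$ that makes $X^b$, with $\pi^b$, intermediate between $X$ and $X'$, and $X^b$ is the biggest among the intermediate sets $Y$ for which $Y\to X$ is a biregular isomorphism: for each such $Y$ one has $\mathrm{Pol}(Y)\subset\mathrm{Pol}(X^b)$ inside $\mathrm{Pol}(X')$. -/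

import Mathlib

namespace RealAlg

/-- A real algebraic set in `ℝⁿ`: the set of common real zeros of an ideal of polynomials. -/
def IsAlgebraicSet {n : ℕ} (X : Set (Fin n → ℝ)) : Prop :=
  ∃ I : Ideal (MvPolynomial (Fin n) ℝ), X = MvPolynomial.zeroLocus ℝ I

/-- The ring of polynomial functions on `S ⊆ ℝⁿ`, as a subalgebra of the functions `S → ℝ`;
it is the image of `ℝ[x₁, …, xₙ]`, hence the quotient of `ℝ[x₁, …, xₙ]` by the ideal of
all polynomials that vanish on `S`. -/
noncomputable def Pol {n : ℕ} (S : Set (Fin n → ℝ)) : Subalgebra ℝ (S → ℝ) :=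
  (MvPolynomial.aeval (R := ℝ) (fun (i : Fin n) (x : S) => x.1 i)).range

theorem aeval_coord_apply {n : ℕ} {S : Set (Fin n → ℝ)} (p : MvPolynomial (Fin n) ℝ) (x : S) :
    MvPolynomial.aeval (R := ℝ) (fun (i : Fin n) (x : S) => x.1 i) p x
      = MvPolynomial.eval x.1 p := by
  induction p using MvPolynomial.induction_on with
  | C a => simp
  | add p q hp hq => simp [hp, hq]
  | mul_X p i hp => simp [hp]

theorem mem_Pol_iff {n : ℕ} {S : Set (Fin n → ℝ)} {f : S → ℝ} :
    f ∈ Pol S ↔ ∃ p : MvPolynomial (Fin n) ℝ, ∀ x : S, f x = MvPolynomial.eval x.1 p := by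
  constructor
  · rintro ⟨p, rfl⟩
    exact ⟨p, fun x => aeval_coord_apply p x⟩
  · rintro ⟨p, hp⟩
    exact ⟨p, funext fun x => (aeval_coord_apply p x).trans (hp x).symm⟩

/-- The ring of regular functions on `S ⊆ ℝⁿ`: the functions `p / q` with `p`, `q` polynomials
and `q` without zeros on `S`. It is used for algebraic sets and for their Zariski open subsets. -/
def Reg {n : ℕ} (S : Set (Fin n → ℝ)) : Subalgebra ℝ (S → ℝ) where
  carrier := {f | ∃ p q : MvPolynomial (Fin n) ℝ, ∀ x : S,
    MvPolynomial.eval x.1 q ≠ 0 ∧ f x = MvPolynomial.eval x.1 p / MvPolynomial.eval x.1 q}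
  mul_mem' := by
    rintro f g ⟨p, q, h⟩ ⟨p', q', h'⟩
    refine ⟨p * p', q * q', fun x => ⟨?_, ?_⟩⟩
    · simpa using ⟨(h x).1, (h' x).1⟩
    · simp [(h x).2, (h' x).2, div_mul_div_comm]
  add_mem' := by
    rintro f g ⟨p, q, h⟩ ⟨p', q', h'⟩
    refine ⟨p * q' + q * p', q * q', fun x => ⟨?_, ?_⟩⟩
    · simpa using ⟨(h x).1, (h' x).1⟩
    · simp [(h x).2, (h' x).2, div_add_div _ _ (h x).1 (h' x).1]
  algebraMap_mem' := fun r => ⟨MvPolynomial.C r, 1, fun x => by simp⟩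

theorem Pol_le_Reg {n : ℕ} (S : Set (Fin n → ℝ)) : Pol S ≤ Reg S := by
  intro f hf
  obtain ⟨p, hp⟩ := mem_Pol_iff.1 hf
  exact ⟨p, 1, fun x => by simp [hp x]⟩

/-- `Reg S` is an algebra over `Pol S` through the inclusion. -/
noncomputable instance instAlgebraPolReg {n : ℕ} (S : Set (Fin n → ℝ)) :
    Algebra (Pol S) (Reg S) :=
  (Subalgebra.inclusion (Pol_le_Reg S)).toRingHom.toAlgebra

/-- A polynomial map: its coordinate functions are polynomial functions. -/
def IsPolynomialMap {n m : ℕ} {X : Set (Fin n → ℝ)} {Y : Set (Fin m → ℝ)} (φ : X → Y) : Prop :=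
  ∀ i : Fin m, (fun x : X => (φ x).1 i) ∈ Pol X

/-- A regular map: its coordinate functions are regular functions. -/
def IsRegularMap {n m : ℕ} {X : Set (Fin n → ℝ)} {Y : Set (Fin m → ℝ)} (φ : X → Y) : Prop :=
  ∀ i : Fin m, (fun x : X => (φ x).1 i) ∈ Reg X

/-- A biregular isomorphism: a regular map that has a regular inverse. -/
def IsBiregularIso {n m : ℕ} {X : Set (Fin n → ℝ)} {Y : Set (Fin m → ℝ)} (φ : X → Y) : Prop :=
  IsRegularMap φ ∧ ∃ ψ : Y → X, IsRegularMap ψ ∧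
    Function.LeftInverse ψ φ ∧ Function.RightInverse ψ φ

theorem IsPolynomialMap.comp_mem {n m : ℕ} {X : Set (Fin n → ℝ)} {Y : Set (Fin m → ℝ)}
    {φ : X → Y} (hφ : IsPolynomialMap φ) {f : Y → ℝ} (hf : f ∈ Pol Y) : f ∘ φ ∈ Pol X := by
  obtain ⟨p, hp⟩ := mem_Pol_iff.1 hf
  choose q hq using fun i => mem_Pol_iff.1 (hφ i)
  refine mem_Pol_iff.2 ⟨MvPolynomial.bind₁ q p, fun x => ?_⟩
  have h1 : (φ x).1 = fun i => MvPolynomial.eval x.1 (q i) := funext fun i => hq i x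
  rw [Function.comp_apply, hp, h1]
  simp only [← MvPolynomial.coe_aeval_eq_eval, RingHom.coe_coe, MvPolynomial.aeval_bind₁]

/-- The homomorphism `Pol Y → Pol X`, `f ↦ f ∘ φ`, induced by a polynomial map `φ : X → Y`. -/
noncomputable def pullback {n m : ℕ} {X : Set (Fin n → ℝ)} {Y : Set (Fin m → ℝ)} {φ : X → Y}
    (hφ : IsPolynomialMap φ) : Pol Y →ₐ[ℝ] Pol X where
  toFun f := ⟨f.1 ∘ φ, hφ.comp_mem f.2⟩
  map_one' := rfl
  map_mul' _ _ := rfl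
  map_zero' := rfl
  map_add' _ _ := rfl
  commutes' _ := rfl

/-- `U` is a Zariski open subset of `X`. -/
def IsZariskiOpenIn {n : ℕ} (U X : Set (Fin n → ℝ)) : Prop :=
  ∃ W : Set (Fin n → ℝ), IsAlgebraicSet W ∧ U = X \ W

/-- `U` is a Zariski dense subset of `X`. -/
def IsZariskiDenseIn {n : ℕ} (U X : Set (Fin n → ℝ)) : Prop :=
  U ⊆ X ∧ ∀ W : Set (Fin n → ℝ), IsAlgebraicSet W → U ⊆ W → X ⊆ W

/-- A map is birational if it induces a biregular isomorphism between Zariski dense, Zariski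
open subsets of its source and of its target. -/
def IsBirational {n m : ℕ} {X : Set (Fin n → ℝ)} {Y : Set (Fin m → ℝ)} (φ : X → Y) : Prop :=
  ∃ (U : Set (Fin n → ℝ)) (V : Set (Fin m → ℝ)),
    IsZariskiOpenIn U X ∧ IsZariskiDenseIn U X ∧ IsZariskiOpenIn V Y ∧ IsZariskiDenseIn V Y ∧
    ∃ ψ : U → V, IsBiregularIso ψ ∧ ∀ (x : X) (hx : x.1 ∈ U), (ψ ⟨x.1, hx⟩).1 = (φ x).1

/-- A finite birational polynomial map `φ : X → Y`; finite means that `Pol X` is a finitely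
generated module over `Pol Y`. -/
structure IsFiniteBirational {n m : ℕ} {X : Set (Fin n → ℝ)} {Y : Set (Fin m → ℝ)}
    (φ : X → Y) : Prop where
  polynomial : IsPolynomialMap φ
  finite : (pullback polynomial).toRingHom.Finite
  birational : IsBirational φ

/-- `π : Z → X` exhibits `Z` as the normalization of `X`: the homomorphism `Pol X → Pol Z` it
induces is identified with the inclusion of `Pol X` in its integral closure in its total ring of
fractions. (`FractionRing` is the localization at all non-zero-divisors.) -/
def IsNormalization {n m : ℕ} {X : Set (Fin n → ℝ)} {Z : Set (Fin m → ℝ)} (π : Z → X) : Prop :=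
  ∃ (hπ : IsPolynomialMap π) (e : Pol Z ≃+* integralClosure (Pol X) (FractionRing (Pol X))),
    ∀ f : Pol X, (e (pullback hπ f) : FractionRing (Pol X)) = algebraMap _ _ f

/-- `π : Z → X` exhibits `Z` as the biregular normalization of `X`: the homomorphism
`Pol X → Pol Z` it induces is identified with the inclusion of `Pol X` in its integral closure
in the ring of regular functions on `X`. -/
def IsBiregularNormalization {n m : ℕ} {X : Set (Fin n → ℝ)} {Z : Set (Fin m → ℝ)}
    (π : Z → X) : Prop :=
  ∃ (hπ : IsPolynomialMap π) (e : Pol Z ≃+* integralClosure (Pol X) (Reg X)),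
    ∀ f : Pol X, (e (pullback hπ f) : Reg X) = algebraMap _ _ f

/-- Given `π' : X' → X`, the algebraic set `Y` with the maps `φ : X' → Y` and `π : Y → X` is
intermediate between `X` and `X'`: one has `Pol X ⊆ Pol Y ⊆ Pol X'` through the induced
homomorphisms. -/
structure IsIntermediate {n k m : ℕ} {X : Set (Fin n → ℝ)} {X' : Set (Fin k → ℝ)}
    {Y : Set (Fin m → ℝ)} (π' : X' → X) (φ : X' → Y) (π : Y → X) : Prop where
  algebraic : IsAlgebraicSet Y
  polynomial_up : IsPolynomialMap φ
  polynomial_down : IsPolynomialMap π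
  comp_eq : π ∘ φ = π'
  injective_up : Function.Injective (pullback polynomial_up)
  injective_down : Function.Injective (pullback polynomial_down)

end RealAlg

open RealAlg

namespace RealAlg

/-! Real algebraic sets are dual to their rings of polynomial functions: every ring homomorphism
`Pol X → ℝ` is evaluation at a point of `X` (`IsAlgebraicSet.exists_eq_eval`), and a ring of finite
type over `Pol X` is some `Pol Z` once its real points separate its elements
(`IsAlgebraicSet.exists_Pol_equiv`). So each normalization needs finiteness and enough real points.

Finiteness in the total ring of fractions is the classical theorem for reduced algebras of finite
type in characteristic 0; the closure in `Reg X` is a submodule of that one. For `X'`, a common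
denominator `s` provides the points: where `s(x) ≠ 0`, evaluation extends by `b ↦ (s b)(x) / s(x)`,
which also gives birationality. For the biregular normalization, elements are functions on `X` and
every point of `X` gives an evaluation; these evaluations form the regular inverse of `πb`.

Maximality rests on `IsBiregularNormalization.exists_eq_of_isIntegralElem`: if `Y → X` has a regular
inverse, a function on `Y` integral over `Pol X` transports to an integral regular function on `X`,
hence to an element of `Pol Xb`. -/

/-! ### Finiteness of the integral closure and common denominators -/

theorem finite_integralClosure_fractionRing_of_isDomain (k A : Type*) [Field k] [CharZero k]
    [CommRing A] [IsDomain A] [Algebra k A] [Algebra.FiniteType k A] :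
    Module.Finite A (integralClosure A (FractionRing A)) := by
  -- Noether normalization: `A` is finite over a polynomial ring, which is integrally closed, and `L
  -- / K` is finite and separable in characteristic 0.
  obtain ⟨s, g, hg, hfin⟩ := exists_finite_inj_algHom_of_fg k A
  let := g.toRingHom.toAlgebra
  let L := FractionRing A
  let K := FractionRing (MvPolynomial (Fin s) k)
  have : IsScalarTower (MvPolynomial (Fin s) k) A L := inferInstance
  have hfin' : Module.Finite (MvPolynomial (Fin s) k) A := hfin
  have hinj : Function.Injective (algebraMap (MvPolynomial (Fin s) k) L) := by
    rw [IsScalarTower.algebraMap_eq _ A L]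
    exact (IsFractionRing.injective A L).comp hg
  have : Module.IsTorsionFree (MvPolynomial (Fin s) k) A :=
    Module.isTorsionFree_iff_algebraMap_injective.2 hg
  have : FaithfulSMul (MvPolynomial (Fin s) k) L :=
    (faithfulSMul_iff_algebraMap_injective _ _).2 hinj
  let : Algebra K L := FractionRing.liftAlgebra _ _
  have : IsScalarTower (MvPolynomial (Fin s) k) K L := inferInstance
  have : Algebra.IsIntegral (MvPolynomial (Fin s) k) A := inferInstance
  have : FiniteDimensional K L := by
    have : IsLocalization
        (Algebra.algebraMapSubmonoid A (nonZeroDivisors (MvPolynomial (Fin s) k))) L :=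
      inferInstance
    exact Module.Finite.of_isLocalization (MvPolynomial (Fin s) k) A (nonZeroDivisors _)
  have : CharZero K :=
    charZero_of_injective_algebraMap (IsFractionRing.injective (MvPolynomial (Fin s) k) K)
  -- Since `A` is integral over the polynomial ring, both have the same integral closure in `L`.
  have : Module.Finite (MvPolynomial (Fin s) k) (integralClosure A L) := by
    have : IsIntegralClosure (integralClosure A L) (MvPolynomial (Fin s) k) L :=
      ⟨Subtype.coe_injective, fun {x} => ⟨fun hx => ⟨⟨x, hx.tower_top⟩, rfl⟩, by
        rintro ⟨y, rfl⟩; exact isIntegral_trans (A := A) _ y.2⟩⟩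
    exact IsIntegralClosure.finite _ K L _
  exact Module.Finite.of_restrictScalars_finite (MvPolynomial (Fin s) k) _ _

/-- As `A` is reduced, its total ring of fractions embeds in the finite product of the fraction
fields of `A ⧸ p`, `p` a minimal prime. The closure thus embeds in a finite module over a noetherian
ring. -/
theorem finite_integralClosure_fractionRing (k A : Type*) [Field k] [CharZero k]
    [CommRing A] [IsReduced A] [Algebra k A] [Algebra.FiniteType k A] :
    Module.Finite A (integralClosure A (FractionRing A)) := by
  have : IsNoetherianRing A := Algebra.FiniteType.isNoetherianRing k A
  have : Finite (minimalPrimes A) := (minimalPrimes.finite_of_isNoetherianRing A).to_subtype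
  have hp (p : minimalPrimes A) : p.1.IsPrime := p.2.1.1
  let F (p : minimalPrimes A) := FractionRing (A ⧸ p.1)
  have hu (p : minimalPrimes A) (s : nonZeroDivisors A) : IsUnit (algebraMap A (F p) s) := by
    rw [isUnit_iff_ne_zero, IsScalarTower.algebraMap_apply A (A ⧸ p.1) (F p), Ne,
      FaithfulSMul.algebraMap_eq_zero_iff]
    exact fun h => notMem_nonZeroDivisors_of_mem_mem_minimalPrimes
      (Ideal.Quotient.eq_zero_iff_mem.1 h) p.2 s.2
  let j (p : minimalPrimes A) : FractionRing A →ₐ[A] F p :=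
    IsLocalization.liftAlgHom (M := nonZeroDivisors A) (f := Algebra.ofId A (F p)) (hu p)
  have hj : ∀ x : FractionRing A, (∀ p, j p x = 0) → x = 0 := by
    intro x hx
    obtain ⟨a, s, rfl⟩ := IsLocalization.exists_mk'_eq (nonZeroDivisors A) x
    rw [IsLocalization.mk'_eq_zero_iff]
    refine ⟨1, ?_⟩
    have : a ∈ sInf (minimalPrimes A) := by
      rw [Submodule.mem_sInf]
      intro p hp'
      have h := hx ⟨p, hp'⟩
      change IsLocalization.lift (hu ⟨p, hp'⟩) _ = 0 at h
      rw [IsLocalization.lift_mk'_spec, mul_zero,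
        IsScalarTower.algebraMap_apply A (A ⧸ p) (F ⟨p, hp'⟩)] at h
      exact Ideal.Quotient.eq_zero_iff_mem.1
        ((FaithfulSMul.algebraMap_eq_zero_iff (A ⧸ p) (F ⟨p, hp'⟩)).1 h)
    have h0 : a ∈ (⊥ : Ideal A).radical := Ideal.sInf_minimalPrimes (I := (⊥ : Ideal A)) ▸ this
    have : IsNilpotent a := h0
    rw [this.eq_zero, mul_zero]
  have (p : minimalPrimes A) : Module.Finite A (integralClosure (A ⧸ p.1) (F p)) := by
    have h : Module.Finite _ (integralClosure (A ⧸ p.1) (F p)) :=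
      finite_integralClosure_fractionRing_of_isDomain k (A ⧸ p.1)
    exact Module.Finite.trans (A ⧸ p.1) _
  let Φ : integralClosure A (FractionRing A) →ₗ[A] ∀ p, integralClosure (A ⧸ p.1) (F p) :=
    LinearMap.pi fun p =>
      { toFun := fun x => ⟨j p x, (x.2.map (j p)).tower_top⟩
        map_add' := fun x y => by ext; simp
        map_smul' := fun x y => by ext; simp }
  exact Module.Finite.of_injective Φ ((injective_iff_map_eq_zero Φ).2 fun x hx =>
    Subtype.ext (hj _ fun p => congrArg Subtype.val (congrFun hx p)))

theorem exists_nonZeroDivisors_mul_mem_range_of_finite {A : Type*} [CommRing A]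
    [Module.Finite A (integralClosure A (FractionRing A))] :
    ∃ s ∈ nonZeroDivisors A, ∀ b ∈ integralClosure A (FractionRing A),
      ∃ a : A, algebraMap A (FractionRing A) a = algebraMap A (FractionRing A) s * b := by
  have hfg : (Subalgebra.toSubmodule (integralClosure A (FractionRing A))).FG :=
    Module.Finite.iff_fg.1 ‹_›
  obtain ⟨s, hs, h⟩ := FractionalIdeal.isFractional_of_fg (S := nonZeroDivisors A) hfg
  refine ⟨s, hs, fun b hb => ?_⟩
  obtain ⟨a, ha⟩ := h b hb
  exact ⟨a, by rw [ha, Algebra.smul_def]⟩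

/-! ### Duality between algebraic sets and rings of polynomial functions -/

variable {n m k l : ℕ}

/-- A shortcut instance. -/
noncomputable abbrev commRingPol (S : Set (Fin n → ℝ)) : CommRing (Pol S) :=
  Subalgebra.toCommRing (Pol S)

/-- A shortcut instance. -/
noncomputable abbrev commRingReg (S : Set (Fin n → ℝ)) : CommRing (Reg S) :=
  Subalgebra.toCommRing (Reg S)

attribute [local instance] commRingPol commRingReg

/-- The restriction of polynomials to a set, as a homomorphism onto the polynomial functions. -/
noncomputable def restrict (S : Set (Fin n → ℝ)) : MvPolynomial (Fin n) ℝ →ₐ[ℝ] Pol S :=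
  (MvPolynomial.aeval (R := ℝ) (fun (i : Fin n) (x : S) => x.1 i)).rangeRestrict

theorem restrict_surjective (S : Set (Fin n → ℝ)) : Function.Surjective (restrict S) :=
  AlgHom.rangeRestrict_surjective _

theorem restrict_apply {S : Set (Fin n → ℝ)} (p : MvPolynomial (Fin n) ℝ) (x : S) :
    (restrict S p).1 x = MvPolynomial.eval x.1 p :=
  aeval_coord_apply p x

theorem coord_mem_Pol (S : Set (Fin n → ℝ)) (i : Fin n) : (fun x : S => x.1 i) ∈ Pol S :=
  mem_Pol_iff.2 ⟨MvPolynomial.X i, fun x => by simp⟩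

theorem pullback_apply {X : Set (Fin n → ℝ)} {Y : Set (Fin m → ℝ)} {φ : X → Y}
    (hφ : IsPolynomialMap φ) (f : Pol Y) (x : X) : (pullback hφ f).1 x = f.1 (φ x) := rfl

instance (S : Set (Fin n → ℝ)) : IsReduced (Pol S) :=
  isReduced_of_injective (Pol S).val Subtype.coe_injective

instance (S : Set (Fin n → ℝ)) : Algebra.FiniteType ℝ (Pol S) :=
  Algebra.FiniteType.of_surjective (restrict S) (restrict_surjective S)

instance (S : Set (Fin n → ℝ)) : IsNoetherianRing (Pol S) :=
  Algebra.FiniteType.isNoetherianRing ℝ _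

/-- The identity is the only ring endomorphism of `ℝ`, so linearity over `ℝ` is automatic. -/
theorem _root_.MvPolynomial.ringHom_real_eq_eval {σ : Type*} (χ : MvPolynomial σ ℝ →+* ℝ)
    (p : MvPolynomial σ ℝ) : χ p = MvPolynomial.eval (fun i => χ (MvPolynomial.X i)) p := by
  have : χ = MvPolynomial.eval (fun i => χ (MvPolynomial.X i)) := by
    refine MvPolynomial.ringHom_ext (fun r => ?_) (fun i => by simp)
    rw [MvPolynomial.eval_C]
    exact congrArg (fun f : ℝ →+* ℝ => f r)
      (Subsingleton.elim (χ.comp MvPolynomial.C) (RingHom.id ℝ))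
  exact DFunLike.congr_fun this p

theorem mem_zeroLocus_iff_eval {I : Ideal (MvPolynomial (Fin n) ℝ)} {x : Fin n → ℝ} :
    x ∈ MvPolynomial.zeroLocus ℝ I ↔ ∀ p ∈ I, MvPolynomial.eval x p = 0 :=
  MvPolynomial.mem_zeroLocus_iff

theorem IsAlgebraicSet.exists_eq_eval {X : Set (Fin n → ℝ)} (hX : IsAlgebraicSet X)
    (χ : Pol X →+* ℝ) : ∃ x : X, ∀ f, χ f = f.1 x := by
  have hχ := MvPolynomial.ringHom_real_eq_eval (χ.comp (restrict X).toRingHom)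
  set x : Fin n → ℝ := fun i => χ.comp (restrict X).toRingHom (MvPolynomial.X i)
  have hx : x ∈ X := by
    obtain ⟨I, hI⟩ := hX
    rw [hI, MvPolynomial.mem_zeroLocus_iff]
    intro p hp
    have h0 : restrict X p = 0 := Subtype.ext <| funext fun y => by
      rw [restrict_apply]
      exact mem_zeroLocus_iff_eval.1 (hI ▸ y.2) p hp
    have := hχ p
    simpa [h0] using this.symm
  refine ⟨⟨x, hx⟩, fun f => ?_⟩
  obtain ⟨p, rfl⟩ := restrict_surjective X f
  rw [restrict_apply]
  exact hχ p

/-- The evaluation of polynomial functions at a point. -/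
noncomputable def evalAt {S : Set (Fin n → ℝ)} (x : S) : Pol S →+* ℝ :=
  (Pi.evalRingHom (fun _ : S => ℝ) x).comp (Pol S).val.toRingHom

theorem eq_of_forall_Pol_eq {S : Set (Fin n → ℝ)} {x y : S} (h : ∀ f : Pol S, f.1 x = f.1 y) :
    x = y :=
  Subtype.ext <| funext fun i => h ⟨_, coord_mem_Pol S i⟩

theorem IsAlgebraicSet.exists_pullback_eq {S : Set (Fin k → ℝ)} {X : Set (Fin n → ℝ)}
    (hX : IsAlgebraicSet X) (h : Pol X →+* Pol S) :
    ∃ (φ : S → X) (hφ : IsPolynomialMap φ), ∀ f, pullback hφ f = h f := by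
  choose φ hφ using fun s : S => hX.exists_eq_eval ((evalAt s).comp h)
  have hφ' : ∀ f : Pol X, f.1 ∘ φ = (h f).1 := fun f => funext fun s => (hφ s f).symm
  exact ⟨φ, fun i => (congrArg (· ∈ Pol S) (hφ' ⟨_, coord_mem_Pol X i⟩)).mpr (h _).2, fun f => Subtype.ext (hφ' f)⟩

/-- A ring of finite type over the polynomial functions of an algebraic set is the ring of
polynomial functions of an algebraic set if its real points separate its elements. -/
theorem IsAlgebraicSet.exists_Pol_equiv {X : Set (Fin n → ℝ)} (hX : IsAlgebraicSet X)
    {B : Type*} [CommRing B] (ι : Pol X →+* B) (hι : ι.FiniteType)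
    (hB : ∀ b : B, b ≠ 0 → ∃ χ : B →+* ℝ, χ b ≠ 0) :
    ∃ (m : ℕ) (Z : Set (Fin m → ℝ)) (π : Z → X), IsAlgebraicSet Z ∧
      ∃ (hπ : IsPolynomialMap π) (e : Pol Z ≃+* B), ∀ f, e (pullback hπ f) = ι f := by
  let : Algebra ℝ B := (ι.comp (algebraMap ℝ (Pol X))).toAlgebra
  have hft : Algebra.FiniteType ℝ B := by
    have : (algebraMap ℝ (Pol X)).FiniteType := by
      rw [RingHom.finiteType_algebraMap]; infer_instance
    exact (RingHom.finiteType_algebraMap).1 (hι.comp this)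
  obtain ⟨m, F, hF⟩ := Algebra.FiniteType.iff_quotient_mvPolynomial''.1 hft
  let Z : Set (Fin m → ℝ) := MvPolynomial.zeroLocus ℝ (RingHom.ker F)
  have hZ : IsAlgebraicSet Z := ⟨_, rfl⟩
  -- This replaces a real Nullstellensatz: if `F p ≠ 0`, some real point `χ` detects it, and the
  -- images under `χ` of the generators form a point of `Z` where `p` does not vanish.
  have hker : RingHom.ker (restrict Z) = RingHom.ker F := by
    refine le_antisymm (fun p hp => ?_) (fun p hp => ?_)
    · by_contra hne
      obtain ⟨χ, hχ⟩ := hB (F p) hne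
      have h := MvPolynomial.ringHom_real_eq_eval (χ.comp F.toRingHom)
      have hz : (fun i => χ.comp F.toRingHom (MvPolynomial.X i)) ∈ Z := by
        rw [mem_zeroLocus_iff_eval]
        intro q hq
        refine (h q).symm.trans ?_
        have : F q = 0 := hq
        simp [this]
      apply hχ
      refine (h p).trans ?_
      have := restrict_apply p ⟨_, hz⟩
      rw [← this, RingHom.mem_ker.1 hp]
      rfl
    · refine RingHom.mem_ker.2 (Subtype.ext <| funext fun z => ?_)
      rw [restrict_apply]
      exact mem_zeroLocus_iff_eval.1 z.2 p hp
  let e : Pol Z ≃+* B :=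
    (RingHom.quotientKerEquivOfSurjective (f := (restrict Z).toRingHom)
      (restrict_surjective Z)).symm.trans
      ((Ideal.quotEquivOfEq hker).trans
        (RingHom.quotientKerEquivOfSurjective (f := F.toRingHom) hF))
  obtain ⟨π, hπ, h⟩ := hX.exists_pullback_eq (e.symm.toRingHom.comp ι)
  exact ⟨m, Z, π, hZ, hπ, e, fun f => by rw [h]; simp⟩

/-! ### Regular functions as a localization inside the total ring of fractions -/

theorem algebraMap_Reg_apply {S : Set (Fin n → ℝ)} (f : Pol S) (x : S) :
    (algebraMap (Pol S) (Reg S) f).1 x = f.1 x := rfl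

theorem algebraMap_Reg_injective (S : Set (Fin n → ℝ)) :
    Function.Injective (algebraMap (Pol S) (Reg S)) :=
  Subalgebra.inclusion_injective (Pol_le_Reg S)

theorem exists_mul_eq_algebraMap_Reg {S : Set (Fin n → ℝ)} (f : Reg S) :
    ∃ p q : Pol S, (∀ x, q.1 x ≠ 0) ∧
      f * algebraMap (Pol S) (Reg S) q = algebraMap (Pol S) (Reg S) p := by
  obtain ⟨p, q, h⟩ := f.2
  refine ⟨restrict S p, restrict S q, fun x => ?_, Subtype.ext <| funext fun x => ?_⟩
  · rw [restrict_apply]; exact (h x).1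
  · change f.1 x * (restrict S q).1 x = (restrict S p).1 x
    rw [restrict_apply, restrict_apply, (h x).2, div_mul_cancel₀ _ (h x).1]

theorem inv_mem_Reg {S : Set (Fin n → ℝ)} {f : S → ℝ} (hf : f ∈ Reg S) (h0 : ∀ x, f x ≠ 0) :
    f⁻¹ ∈ Reg S := by
  obtain ⟨p, q, h⟩ := hf
  refine ⟨q, p, fun x => ⟨fun hp => h0 x ?_, ?_⟩⟩
  · rw [(h x).2, hp, zero_div]
  · rw [Pi.inv_apply, (h x).2, inv_div]

/-- The polynomial functions without zeros. -/
def nowhereZero (S : Set (Fin n → ℝ)) : Submonoid (Pol S) where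
  carrier := {f | ∀ x, f.1 x ≠ 0}
  mul_mem' hf hg x := mul_ne_zero (hf x) (hg x)
  one_mem' _ := one_ne_zero

theorem nowhereZero_le_nonZeroDivisors (S : Set (Fin n → ℝ)) :
    nowhereZero S ≤ nonZeroDivisors (Pol S) := by
  intro f hf
  rw [mem_nonZeroDivisors_iff_right]
  intro g hg
  refine Subtype.ext <| funext fun x => ?_
  have : g.1 x * f.1 x = 0 := congrFun (congrArg Subtype.val hg) x
  exact (mul_eq_zero.1 this).resolve_right (hf x)

instance isLocalization_Reg (S : Set (Fin n → ℝ)) : IsLocalization (nowhereZero S) (Reg S) where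
  map_units f := by
    refine IsUnit.of_mul_eq_one ⟨f.1.1⁻¹, inv_mem_Reg (Pol_le_Reg S f.1.2) f.2⟩ ?_
    exact Subtype.ext <| funext fun x => mul_inv_cancel₀ (f.2 x)
  surj f := by
    obtain ⟨p, q, hq, h⟩ := exists_mul_eq_algebraMap_Reg f
    exact ⟨(p, ⟨q, hq⟩), h⟩
  exists_of_eq h := ⟨1, by rw [algebraMap_Reg_injective S h]⟩

/-- The regular functions inside the total ring of fractions. -/
noncomputable def regToFractionRing (S : Set (Fin n → ℝ)) :
    Reg S →ₐ[Pol S] FractionRing (Pol S) :=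
  IsLocalization.liftAlgHom (M := nowhereZero S) (f := Algebra.ofId (Pol S) _) fun s =>
    IsLocalization.map_units _
      (⟨s.1, nowhereZero_le_nonZeroDivisors S s.2⟩ : nonZeroDivisors (Pol S))

theorem regToFractionRing_injective (S : Set (Fin n → ℝ)) :
    Function.Injective (regToFractionRing S) :=
  (IsLocalization.lift_injective_iff _).2 fun _ _ =>
    ((algebraMap_Reg_injective S).eq_iff).trans
      (IsFractionRing.injective (Pol S) (FractionRing (Pol S))).eq_iff.symm

/-- The integral closure in the regular functions inside the one in the total ring of fractions. -/
noncomputable def integralClosureRegToFractionRing (S : Set (Fin n → ℝ)) :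
    integralClosure (Pol S) (Reg S) →ₐ[Pol S] integralClosure (Pol S) (FractionRing (Pol S)) :=
  (regToFractionRing S).mapIntegralClosure

theorem integralClosureRegToFractionRing_injective (S : Set (Fin n → ℝ)) :
    Function.Injective (integralClosureRegToFractionRing S) := fun _ _ h =>
  Subtype.ext (regToFractionRing_injective S (congrArg Subtype.val h))

instance finite_integralClosure_fractionRing_Pol (S : Set (Fin n → ℝ)) :
    Module.Finite (Pol S) (integralClosure (Pol S) (FractionRing (Pol S))) :=
  finite_integralClosure_fractionRing ℝ (Pol S)

instance finite_integralClosure_Reg (S : Set (Fin n → ℝ)) :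
    Module.Finite (Pol S) (integralClosure (Pol S) (Reg S)) :=
  Module.Finite.of_injective (integralClosureRegToFractionRing S).toLinearMap
    (integralClosureRegToFractionRing_injective S)

/-! ### Existence of the two normalizations -/

/-- A point where a conductor element `s` does not vanish extends to a real point of the larger
ring. -/
theorem exists_ringHom_of_conductor {S : Set (Fin n → ℝ)} {B : Type*} [CommRing B]
    {ι : Pol S →+* B} (hι : Function.Injective ι) {s : Pol S}
    (h : ∀ b, ∃ a, ι a = ι s * b) {x : S} (hx : s.1 x ≠ 0) :
    ∃ χ : B →+* ℝ, ∀ a b, ι a = ι s * b → χ b = a.1 x / s.1 x := by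
  -- `c b` is the product `s b` read in `Pol S`; by injectivity of `ι` it is unique, so the ring
  -- identities for `b ↦ (c b)(x) / s(x)` reduce to identities among the `c b`.
  choose c hc using h
  have key : ∀ a b, ι a = ι s * b → a = c b := fun a b hab => hι (hab.trans (hc b).symm)
  have h1 : s = c 1 := key _ _ (by simp)
  have h0 : 0 = c 0 := key _ _ (by simp)
  have hadd (b b' : B) : c b + c b' = c (b + b') := key _ _ (by rw [map_add, hc, hc, mul_add])
  have hmul (b b' : B) : c b * c b' = s * c (b * b') :=
    hι (by rw [map_mul, map_mul, hc, hc, hc]; ring)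
  refine ⟨{ toFun := fun b => (c b).1 x / s.1 x
            map_one' := by rw [← h1, div_self hx]
            map_zero' := by rw [← h0]; exact zero_div _
            map_add' := fun b b' => by rw [← hadd]; exact add_div _ _ _
            map_mul' := fun b b' => ?_ }, fun a b hab => by rw [key a b hab]; rfl⟩
  have := congrFun (congrArg Subtype.val (hmul b b')) x
  change (c b).1 x * (c b').1 x = s.1 x * (c (b * b')).1 x at this
  rw [div_mul_div_comm, this, mul_div_mul_left _ _ hx]

theorem IsAlgebraicSet.exists_isNormalization {X : Set (Fin n → ℝ)} (hX : IsAlgebraicSet X) :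
    ∃ (k : ℕ) (X' : Set (Fin k → ℝ)) (π' : X' → X), IsAlgebraicSet X' ∧ IsNormalization π' := by
  let B := integralClosure (Pol X) (FractionRing (Pol X))
  obtain ⟨s, hs, hc⟩ := exists_nonZeroDivisors_mul_mem_range_of_finite (A := Pol X)
  have hinj : Function.Injective (algebraMap (Pol X) B) := fun a b h =>
    IsFractionRing.injective (Pol X) (FractionRing (Pol X)) (congrArg Subtype.val h)
  have hc' : ∀ b : B, ∃ a, algebraMap (Pol X) B a = algebraMap (Pol X) B s * b := fun b =>
    (hc b.1 b.2).imp fun a ha => Subtype.ext ha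
  have hfin : (algebraMap (Pol X) B).Finite := RingHom.finite_algebraMap.2 inferInstance
  obtain ⟨k, X', π', hX', hπ', e, he⟩ :=
    hX.exists_Pol_equiv (algebraMap (Pol X) B) hfin.finiteType fun b hb => by
      obtain ⟨a, ha⟩ := hc' b
      have ha0 : a ≠ 0 := by
        rintro rfl
        rw [map_zero] at ha
        have h2 : algebraMap (Pol X) (FractionRing (Pol X)) s * b.1 = 0 :=
          (congrArg Subtype.val ha).symm
        exact hb (Subtype.ext ((IsLocalization.map_units (FractionRing (Pol X))
          (⟨s, hs⟩ : nonZeroDivisors (Pol X))).mul_right_eq_zero.1 h2))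
      -- A point is needed where `s` and `a = s b` are both nonzero: there the extended evaluation
      -- exists and does not kill `b`.
      have hsa : a * s ≠ 0 := fun h => ha0 ((mem_nonZeroDivisors_iff_right.1 hs) a h)
      obtain ⟨x, hx⟩ : ∃ x, (a * s).1 x ≠ 0 := by
        by_contra! hcon
        exact hsa (Subtype.ext (funext hcon))
      have hx' : a.1 x * s.1 x ≠ 0 := hx
      obtain ⟨χ, hχ⟩ := exists_ringHom_of_conductor hinj hc' (right_ne_zero_of_mul hx')
      exact ⟨χ, by
        rw [hχ a b ha]
        exact div_ne_zero (left_ne_zero_of_mul hx') (right_ne_zero_of_mul hx')⟩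
  exact ⟨k, X', π', hX', hπ', e, fun f => congrArg Subtype.val (he f)⟩

theorem IsAlgebraicSet.exists_isBiregularNormalization {X : Set (Fin n → ℝ)}
    (hX : IsAlgebraicSet X) :
    ∃ (m : ℕ) (Xb : Set (Fin m → ℝ)) (πb : Xb → X),
      IsAlgebraicSet Xb ∧ IsBiregularNormalization πb := by
  let B := integralClosure (Pol X) (Reg X)
  have hfin : (algebraMap (Pol X) B).Finite :=
    (RingHom.finite_algebraMap (A := Pol X) (B := B)).2 inferInstance
  obtain ⟨m, Xb, πb, hXb, hπb, e, he⟩ :=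
    hX.exists_Pol_equiv (algebraMap (Pol X) B) hfin.finiteType fun b hb => by
      obtain ⟨x, hx⟩ : ∃ x, b.1.1 x ≠ 0 := by
        by_contra! hcon
        exact hb (Subtype.ext (Subtype.ext (funext hcon)))
      exact ⟨((Pi.evalRingHom (fun _ : X => ℝ) x).comp (Reg X).val.toRingHom).comp
        B.val.toRingHom, hx⟩
  exact ⟨m, Xb, πb, hXb, hπb, e, fun f => congrArg Subtype.val (he f)⟩

/-! ### Zariski density, regular maps and birationality -/

theorem isAlgebraicSet_setOf_eval_eq_zero (p : MvPolynomial (Fin n) ℝ) :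
    IsAlgebraicSet {x | MvPolynomial.eval x p = 0} := by
  refine ⟨Ideal.span {p}, Set.ext fun x => ?_⟩
  rw [mem_zeroLocus_iff_eval]
  refine ⟨fun h q hq => ?_, fun h => h p (Ideal.mem_span_singleton_self p)⟩
  obtain ⟨r, rfl⟩ := Ideal.mem_span_singleton'.1 hq
  rw [map_mul, show MvPolynomial.eval x p = 0 from h, mul_zero]

theorem isZariskiOpenIn_self (S : Set (Fin n → ℝ)) : IsZariskiOpenIn S S := by
  refine ⟨_, isAlgebraicSet_setOf_eval_eq_zero 1, ?_⟩
  simp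

theorem isZariskiDenseIn_self (S : Set (Fin n → ℝ)) : IsZariskiDenseIn S S :=
  ⟨subset_rfl, fun _ _ h => h⟩

/-- Density: if `q` vanishes wherever `f` does not, then `q f = 0` on `S`, which forces `q = 0`
there. -/
theorem exists_isZariskiOpenIn_of_mem_nonZeroDivisors {S : Set (Fin n → ℝ)} {f : Pol S}
    (hf : f ∈ nonZeroDivisors (Pol S)) :
    ∃ U, IsZariskiOpenIn U S ∧ IsZariskiDenseIn U S ∧ ∀ x : S, x.1 ∈ U ↔ f.1 x ≠ 0 := by
  obtain ⟨p, rfl⟩ := restrict_surjective S f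
  have hU (x : S) : x.1 ∈ S \ {x | MvPolynomial.eval x p = 0} ↔ (restrict S p).1 x ≠ 0 := by
    rw [restrict_apply]
    exact ⟨fun h => h.2, fun h => ⟨x.2, h⟩⟩
  refine ⟨_, ⟨_, isAlgebraicSet_setOf_eval_eq_zero p, rfl⟩, ⟨Set.sdiff_subset, ?_⟩, hU⟩
  rintro W ⟨I, rfl⟩ hW x hx
  rw [mem_zeroLocus_iff_eval]
  intro q hq
  have h0 : restrict S q * restrict S p = 0 := Subtype.ext <| funext fun y => by
    change (restrict S q).1 y * (restrict S p).1 y = 0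
    by_cases hy : (restrict S p).1 y = 0
    · rw [hy, mul_zero]
    · rw [restrict_apply q, mem_zeroLocus_iff_eval.1 (hW ((hU y).2 hy)) q hq, zero_mul]
  have := mem_nonZeroDivisors_iff_right.1 hf _ h0
  rw [← restrict_apply q ⟨x, hx⟩, this]
  rfl

theorem eq_of_mem_Reg_of_isZariskiDenseIn {S V : Set (Fin n → ℝ)} (hV : IsZariskiDenseIn V S)
    {f g : S → ℝ} (hf : f ∈ Reg S) (hg : g ∈ Reg S) (h : ∀ x : S, x.1 ∈ V → f x = g x) :
    f = g := by
  obtain ⟨p, q, hpq⟩ := sub_mem hf hg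
  have hsub : S ⊆ {x | MvPolynomial.eval x p = 0} := by
    refine hV.2 _ (isAlgebraicSet_setOf_eval_eq_zero p) fun x hx => ?_
    have := (hpq ⟨x, hV.1 hx⟩).2
    rw [Pi.sub_apply, h _ hx, sub_self, eq_comm, div_eq_zero_iff] at this
    exact this.resolve_right (hpq _).1
  refine funext fun x => sub_eq_zero.1 ?_
  have := (hpq x).2
  rwa [show MvPolynomial.eval x.1 p = 0 from hsub x.2, zero_div] at this

theorem IsPolynomialMap.isRegularMap {X : Set (Fin n → ℝ)} {Y : Set (Fin m → ℝ)} {φ : X → Y}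
    (hφ : IsPolynomialMap φ) : IsRegularMap φ := fun i => Pol_le_Reg X (hφ i)

theorem IsRegularMap.comp_mem {X : Set (Fin n → ℝ)} {Y : Set (Fin m → ℝ)} {φ : X → Y}
    (hφ : IsRegularMap φ) {f : Y → ℝ} (hf : f ∈ Reg Y) : f ∘ φ ∈ Reg X := by
  have hpol (p : MvPolynomial (Fin m) ℝ) :
      (fun x : X => MvPolynomial.eval (φ x).1 p) ∈ Reg X := by
    induction p using MvPolynomial.induction_on with
    | C a => simp only [MvPolynomial.eval_C]; exact (Reg X).algebraMap_mem a
    | add p q hp hq => simp only [map_add]; exact add_mem hp hq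
    | mul_X p i hp => simp only [map_mul, MvPolynomial.eval_X]; exact mul_mem hp (hφ i)
  obtain ⟨p, q, h⟩ := hf
  have hfx : f ∘ φ = (fun x : X => MvPolynomial.eval (φ x).1 p) *
      (fun x : X => MvPolynomial.eval (φ x).1 q)⁻¹ := funext fun x => by
    rw [Function.comp_apply, (h (φ x)).2, div_eq_mul_inv]; rfl
  rw [hfx]
  exact mul_mem (hpol p) (inv_mem_Reg (hpol q) fun x => (h (φ x)).1)

theorem IsRegularMap.comp {X : Set (Fin n → ℝ)} {Y : Set (Fin m → ℝ)} {Z : Set (Fin k → ℝ)}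
    {ψ : Y → Z} (hψ : IsRegularMap ψ) {φ : X → Y} (hφ : IsRegularMap φ) :
    IsRegularMap (ψ ∘ φ) := fun i => hφ.comp_mem (hψ i)

theorem IsBiregularIso.isBirational {X : Set (Fin n → ℝ)} {Y : Set (Fin m → ℝ)} {φ : X → Y}
    (hφ : IsBiregularIso φ) : IsBirational φ :=
  ⟨X, Y, isZariskiOpenIn_self X, isZariskiDenseIn_self X, isZariskiOpenIn_self Y,
    isZariskiDenseIn_self Y, φ, hφ, fun _ _ => rfl⟩

/-- A polynomial map is birational if its target has a conductor element that is not a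
zero divisor. -/
theorem isBirational_of_conductor {Z : Set (Fin k → ℝ)} {Y : Set (Fin m → ℝ)}
    (hZ : IsAlgebraicSet Z) {φ : Z → Y} (hφ : IsPolynomialMap φ)
    (hinj : Function.Injective (pullback hφ)) {s : Pol Y} (hs : s ∈ nonZeroDivisors (Pol Y))
    (hs' : pullback hφ s ∈ nonZeroDivisors (Pol Z))
    (hc : ∀ g, ∃ h, pullback hφ h = pullback hφ s * g) : IsBirational φ := by
  obtain ⟨U, hUo, hUd, hU⟩ := exists_isZariskiOpenIn_of_mem_nonZeroDivisors hs'
  obtain ⟨V, hVo, hVd, hV⟩ := exists_isZariskiOpenIn_of_mem_nonZeroDivisors hs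
  -- The inverse on `V`: evaluation at `y` extends to `Pol Z` because `s(y) ≠ 0`, and the extension
  -- is a point of `Z`.
  have hpt (y : V) : ∃ z : Z, ∀ h g, pullback hφ h = pullback hφ s * g →
      g.1 z = h.1 ⟨y.1, hVd.1 y.2⟩ / s.1 ⟨y.1, hVd.1 y.2⟩ := by
    obtain ⟨χ, hχ⟩ := exists_ringHom_of_conductor (ι := (pullback hφ).toRingHom) hinj hc
      ((hV ⟨y.1, hVd.1 y.2⟩).1 y.2)
    obtain ⟨z, hz⟩ := hZ.exists_eq_eval χ
    exact ⟨z, fun h g hg => (hz g).symm.trans (hχ h g hg)⟩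
  choose ζ hζ using hpt
  have hsV (y : V) : s.1 ⟨y.1, hVd.1 y.2⟩ ≠ 0 := (hV ⟨y.1, hVd.1 y.2⟩).1 y.2
  have hφζ (y : V) : (φ (ζ y)).1 = y.1 := by
    have : φ (ζ y) = ⟨y.1, hVd.1 y.2⟩ := eq_of_forall_Pol_eq fun f => by
      rw [← pullback_apply hφ f, hζ y (s * f) _ (map_mul _ _ _)]
      exact mul_div_cancel_left₀ _ (hsV y)
    rw [this]
  have hζU (y : V) : (ζ y).1 ∈ U := by
    have : φ (ζ y) = ⟨y.1, hVd.1 y.2⟩ := Subtype.ext (hφζ y)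
    rw [hU, pullback_apply, this]
    exact hsV y
  have hφV (u : U) : (φ ⟨u.1, hUd.1 u.2⟩).1 ∈ V := (hV _).2 ((hU ⟨u.1, hUd.1 u.2⟩).1 u.2)
  refine ⟨U, V, hUo, hUd, hVo, hVd, fun u => ⟨(φ ⟨u.1, hUd.1 u.2⟩).1, hφV u⟩,
    ⟨fun i => ?_, fun y => ⟨(ζ y).1, hζU y⟩, fun i => ?_, fun u => ?_, fun y => ?_⟩,
    fun _ _ => rfl⟩
  · obtain ⟨p, hp⟩ := mem_Pol_iff.1 (hφ i)
    exact Pol_le_Reg U (mem_Pol_iff.2 ⟨p, fun u => hp _⟩)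
  -- The coordinates of the inverse are quotients with denominator `s`, which has no zeros on `V`.
  · obtain ⟨h, hh⟩ := hc ⟨_, coord_mem_Pol Z i⟩
    obtain ⟨p, hp⟩ := restrict_surjective Y h
    obtain ⟨q, hq⟩ := restrict_surjective Y s
    refine ⟨p, q, fun y => ⟨?_, ?_⟩⟩
    · rw [← restrict_apply q ⟨y.1, hVd.1 y.2⟩, hq]
      exact hsV y
    · rw [← restrict_apply q ⟨y.1, hVd.1 y.2⟩, hq, ← restrict_apply p ⟨y.1, hVd.1 y.2⟩, hp]
      exact hζ y h _ hh
  · have : ζ ⟨_, hφV u⟩ = ⟨u.1, hUd.1 u.2⟩ := eq_of_forall_Pol_eq fun g => by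
      obtain ⟨h, hh⟩ := hc g
      rw [hζ _ h g hh, div_eq_iff ((hV _).1 (hφV u)), mul_comm]
      exact congrFun (congrArg Subtype.val hh) _
    have h1 : (ζ ⟨_, hφV u⟩).1 = u.1 := by rw [this]
    exact Subtype.ext h1
  · exact Subtype.ext (hφζ y)

/-! ### Properties of the biregular normalization -/

section BiregularNormalization

variable {X : Set (Fin n → ℝ)} {Xb : Set (Fin m → ℝ)} {πb : Xb → X}

/-- The abstract isomorphism `e` is compatible with values: writing `e g = p / q` gives `g · (q ∘
πb) = p ∘ πb`, and `q` has no zeros. -/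
theorem eval_eq_of_biregularNormalization {hπ : IsPolynomialMap πb}
    {e : Pol Xb ≃+* integralClosure (Pol X) (Reg X)}
    (he : ∀ f : Pol X, (e (pullback hπ f) : Reg X) = algebraMap _ _ f) (g : Pol Xb) (z : Xb) :
    (e g).1.1 (πb z) = g.1 z := by
  obtain ⟨p, q, hq, h⟩ := exists_mul_eq_algebraMap_Reg (e g).1
  have h1 : g * pullback hπ q = pullback hπ p := e.injective <| Subtype.ext <| by
    rw [map_mul, he p, ← h, ← he q]; rfl
  have h2 : g.1 z * q.1 (πb z) = p.1 (πb z) := congrFun (congrArg Subtype.val h1) z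
  have h3 : (e g).1.1 (πb z) * q.1 (πb z) = p.1 (πb z) :=
    congrFun (congrArg Subtype.val h) (πb z)
  exact mul_right_cancel₀ (hq _) (h3.trans h2.symm)

/-- Evaluation of regular functions at `x`, composed with `e`, is a point `ψ x` of `Xb`; the
coordinates of `ψ` are images under `e`, hence regular. -/
theorem IsBiregularNormalization.isBiregularIso (hXb : IsAlgebraicSet Xb)
    (h : IsBiregularNormalization πb) : IsBiregularIso πb := by
  obtain ⟨hπ, e, he⟩ := h
  have hpt (x : X) : ∃ z : Xb, ∀ g, g.1 z = (e g).1.1 x := by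
    obtain ⟨z, hz⟩ := hXb.exists_eq_eval
      (((Pi.evalRingHom (fun _ : X => ℝ) x).comp (Reg X).val.toRingHom).comp
        ((integralClosure (Pol X) (Reg X)).val.toRingHom.comp e.toRingHom))
    exact ⟨z, fun g => (hz g).symm⟩
  choose ψ hψ using hpt
  refine ⟨hπ.isRegularMap, ψ, fun i => ?_, fun z => ?_, fun x => ?_⟩
  · have : (fun x => (ψ x).1 i) = (e ⟨_, coord_mem_Pol Xb i⟩).1.1 :=
      funext fun x => hψ x ⟨_, coord_mem_Pol Xb i⟩
    rw [this]
    exact (e _).1.2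
  · exact eq_of_forall_Pol_eq fun g => by
      rw [hψ, eval_eq_of_biregularNormalization he]
  · exact eq_of_forall_Pol_eq fun f => by
      rw [← pullback_apply hπ, hψ, he, algebraMap_Reg_apply]

theorem IsBiregularNormalization.isFiniteBirational (hXb : IsAlgebraicSet Xb)
    (h : IsBiregularNormalization πb) : IsFiniteBirational πb := by
  have hbir := (h.isBiregularIso hXb).isBirational
  obtain ⟨hπ, e, he⟩ := h
  refine ⟨hπ, ?_, hbir⟩
  have hfin : (algebraMap (Pol X) (integralClosure (Pol X) (Reg X))).Finite :=
    RingHom.finite_algebraMap.2 inferInstance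
  have : (pullback hπ).toRingHom = e.symm.toRingHom.comp (algebraMap (Pol X) _) :=
    RingHom.ext fun f => e.injective <| Subtype.ext <| by
      refine (he f).trans ?_
      simp
  rw [this]
  exact (RingHom.Finite.of_surjective _ e.symm.surjective).comp hfin

/-- The function `g ∘ ψ` is regular on `X`, and composing with `ψ` carries the integral equation of
`g` to one over `Pol X` because `π ∘ ψ = id`. -/
theorem IsBiregularNormalization.exists_eq_of_isIntegralElem (h : IsBiregularNormalization πb)
    {Y : Set (Fin l → ℝ)} {π : Y → X} (hπ : IsPolynomialMap π) {ψ : X → Y} (hψ : IsRegularMap ψ)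
    (hπψ : Function.RightInverse ψ π) {g : Pol Y} (hg : (pullback hπ).toRingHom.IsIntegralElem g) :
    ∃ G : Pol Xb, ∀ z, G.1 z = g.1 (ψ (πb z)) := by
  obtain ⟨hπb, e, he⟩ := h
  let c : Pol Y →+* Reg X :=
    { toFun := fun f => ⟨f.1 ∘ ψ, hψ.comp_mem (Pol_le_Reg Y f.2)⟩
      map_one' := rfl
      map_zero' := rfl
      map_add' := fun _ _ => rfl
      map_mul' := fun _ _ => rfl }
  have hc : c.comp (pullback hπ).toRingHom = algebraMap (Pol X) (Reg X) :=
    RingHom.ext fun f => Subtype.ext <| funext fun x => congrArg f.1 (hπψ x)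
  have hint : IsIntegral (Pol X) (c g) := by
    obtain ⟨p, hp, hpg⟩ := hg
    refine ⟨p, hp, ?_⟩
    rw [← hc, ← Polynomial.hom_eval₂, hpg, map_zero]
  refine ⟨e.symm ⟨c g, hint⟩, fun z => ?_⟩
  rw [← eval_eq_of_biregularNormalization he, e.apply_symm_apply]
  rfl

theorem IsBiregularNormalization.isBiregularIso_iff (hXb : IsAlgebraicSet Xb)
    (h : IsBiregularNormalization πb) {Y : Set (Fin l → ℝ)} {π : Y → X}
    (hπ : IsFiniteBirational π) :
    IsBiregularIso π ↔ ∃ θ : Xb → Y, IsFiniteBirational θ ∧ π ∘ θ = πb := by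
  obtain ⟨hrb, ψb, hψb, hlb, hrib⟩ := h.isBiregularIso hXb
  have hfb := h.isFiniteBirational hXb
  constructor
  · rintro ⟨hreg, ψ, hψ, hl, hri⟩
    have hcomp : π ∘ (ψ ∘ πb) = πb := funext fun z => hri _
    have hpol : IsPolynomialMap (ψ ∘ πb) := fun i => by
      obtain ⟨G, hG⟩ := h.exists_eq_of_isIntegralElem hπ.polynomial hψ hri
        (hπ.finite.to_isIntegral ⟨_, coord_mem_Pol Y i⟩)
      have : (fun z => ((ψ ∘ πb) z).1 i) = G.1 := funext fun z => (hG z).symm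
      rw [this]
      exact G.2
    refine ⟨ψ ∘ πb, ⟨hpol, ?_, ?_⟩, hcomp⟩
    · have : ((pullback hpol).toRingHom.comp (pullback hπ.polynomial).toRingHom) =
          (pullback hfb.polynomial).toRingHom := RingHom.ext fun f => Subtype.ext <| funext fun z =>
        congrArg f.1 (congrFun hcomp z)
      -- `Pol Xb` is already finite over `Pol X`, hence over `Pol Y`.
      exact RingHom.Finite.of_comp_finite (this ▸ hfb.finite)
    · exact IsBiregularIso.isBirational ⟨hψ.comp hrb, ψb ∘ π, hψb.comp hreg,
        hri.leftInverse.comp hlb, hl.rightInverse.comp hrib⟩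
  · rintro ⟨θ, hθ, hcomp⟩
    have hσ : IsRegularMap (θ ∘ ψb) := hθ.polynomial.isRegularMap.comp hψb
    refine ⟨hπ.polynomial.isRegularMap, θ ∘ ψb, hσ, ?_, fun x => ?_⟩
    -- `θ ∘ ψb ∘ π` fixes every point in the image of `θ`. By birationality this image contains a
    -- dense set `V`, and regular functions that agree on `V` agree on `Y`.
    · obtain ⟨U, V, -, hU, -, hV, τ, ⟨-, τ', -, -, hτ⟩, hτθ⟩ := hθ.birational
      have hV' (y : Y) (hy : y.1 ∈ V) : θ (ψb (π y)) = y := by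
        obtain ⟨z, rfl⟩ : ∃ z, θ z = y := by
          refine ⟨⟨_, hU.1 (τ' ⟨y.1, hy⟩).2⟩, Subtype.ext ?_⟩
          rw [← hτθ _ (τ' ⟨y.1, hy⟩).2, hτ]
        rw [show π (θ z) = πb z from congrFun hcomp z, hlb]
      refine fun y => Subtype.ext <| funext fun i => ?_
      refine congrFun (eq_of_mem_Reg_of_isZariskiDenseIn hV
        ((hσ.comp hπ.polynomial.isRegularMap) i) (Pol_le_Reg Y (coord_mem_Pol Y i))
        fun y hy => ?_) y
      exact congrArg (fun y : Y => y.1 i) (hV' y hy)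
    · exact (congrFun hcomp _).trans (hrib x)

theorem IsBiregularNormalization.exists_isIntermediate (hXb : IsAlgebraicSet Xb)
    (h : IsBiregularNormalization πb) {X' : Set (Fin k → ℝ)}
    {π' : X' → X} (hX' : IsAlgebraicSet X') (h' : IsNormalization π') :
    ∃ φb : X' → Xb, IsIntermediate π' φb πb ∧ IsFiniteBirational φb := by
  obtain ⟨hπb, e, he⟩ := h
  obtain ⟨hπ', e', he'⟩ := h'
  let E : Pol X' →+* FractionRing (Pol X) :=
    (integralClosure (Pol X) (FractionRing (Pol X))).val.toRingHom.comp e'.toRingHom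
  obtain ⟨φb, hφb, hpull⟩ := hXb.exists_pullback_eq
    (e'.symm.toRingHom.comp ((integralClosureRegToFractionRing X).toRingHom.comp e.toRingHom))
  have hpull' (g : Pol Xb) : (e' (pullback hφb g)).1 = regToFractionRing X (e g).1 := by
    rw [hpull g]
    exact congrArg Subtype.val (e'.apply_symm_apply _)
  have hinj : Function.Injective (pullback hφb) := fun g g' hgg => e.injective <| Subtype.ext <|
    regToFractionRing_injective X (by rw [← hpull', ← hpull', hgg])
  have hinjb : Function.Injective (pullback hπb) := fun f f' hff =>
    algebraMap_Reg_injective X (by rw [← he, ← he, hff])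
  have hpp (f : Pol X) : pullback hφb (pullback hπb f) = pullback hπ' f :=
    e'.injective <| Subtype.ext <| by rw [hpull', he, he', AlgHom.commutes]
  have hcomp : πb ∘ φb = π' := funext fun z => eq_of_forall_Pol_eq fun f =>
    congrFun (congrArg Subtype.val (hpp f)) z
  refine ⟨φb, ⟨hXb, hφb, hπb, hcomp, hinj, hinjb⟩, hφb, ?_, ?_⟩
  · have hfin : (algebraMap (Pol X) (integralClosure (Pol X) (FractionRing (Pol X)))).Finite :=
      RingHom.finite_algebraMap.2 inferInstance
    have : (pullback hφb).toRingHom.comp (pullback hπb).toRingHom =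
        e'.symm.toRingHom.comp (algebraMap (Pol X) _) :=
      RingHom.ext fun f => e'.injective <| Subtype.ext <| by
        refine (congrArg (fun g => (e' g).1) (hpp f)).trans ((he' f).trans ?_)
        simp
    refine RingHom.Finite.of_comp_finite (f := (pullback hπb).toRingHom) ?_
    rw [this]
    exact (RingHom.Finite.of_surjective _ e'.symm.surjective).comp hfin
  -- A common denominator over `Pol X` also serves over the larger ring `Pol Xb`.
  · obtain ⟨s, hs, hc⟩ := exists_nonZeroDivisors_mul_mem_range_of_finite (A := Pol X)
    have hs' : pullback hφb (pullback hπb s) ∈ nonZeroDivisors (Pol X') := by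
      rw [hpp, mem_nonZeroDivisors_iff_right]
      intro g hg
      have h2 : (e' g).1 * algebraMap (Pol X) (FractionRing (Pol X)) s = 0 := by
        rw [← he' s]
        exact (map_mul E _ _).symm.trans ((congrArg E hg).trans (map_zero E))
      refine e'.injective <| Subtype.ext ?_
      rw [map_zero]
      exact (IsLocalization.map_units (FractionRing (Pol X))
          (⟨s, hs⟩ : nonZeroDivisors (Pol X))).mul_left_eq_zero.1 h2
    refine isBirational_of_conductor hX' hφb hinj (s := pullback hπb s) ?_ hs' fun g => ?_
    · rw [mem_nonZeroDivisors_iff_right]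
      intro g hg
      refine hinj ?_
      rw [map_zero]
      exact mem_nonZeroDivisors_iff_right.1 hs' _ (by rw [← map_mul, hg, map_zero])
    · obtain ⟨a, ha⟩ := hc (e' g).1 (e' g).2
      refine ⟨pullback hπb a, e'.injective <| Subtype.ext ?_⟩
      rw [hpp, hpp, he', ha, ← he', map_mul]
      rfl

theorem IsNormalization.isIntegralElem {X' : Set (Fin k → ℝ)} {π' : X' → X}
    (h' : IsNormalization π') (hπ' : IsPolynomialMap π') (g : Pol X') :
    (pullback hπ').toRingHom.IsIntegralElem g := by
  obtain ⟨hπ', e', he'⟩ := h'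
  obtain ⟨p, hp, hpg⟩ := (e' g).2
  refine ⟨p, hp, e'.injective <| Subtype.ext ?_⟩
  let E : Pol X' →+* FractionRing (Pol X) :=
    (integralClosure (Pol X) (FractionRing (Pol X))).val.toRingHom.comp e'.toRingHom
  change E _ = E 0
  rw [Polynomial.hom_eval₂, map_zero]
  have : E.comp (pullback hπ').toRingHom = algebraMap (Pol X) (FractionRing (Pol X)) :=
    RingHom.ext he'
  rw [this]
  exact hpg

theorem IsBiregularNormalization.range_pullback_le (h : IsBiregularNormalization πb)
    {X' : Set (Fin k → ℝ)} {π' : X' → X} (h' : IsNormalization π') {φb : X' → Xb}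
    (hφb : IsIntermediate π' φb πb) {Y : Set (Fin l → ℝ)} {φ : X' → Y} {π : Y → X}
    (hY : IsIntermediate π' φ π) (hπ : IsBiregularIso π) :
    (pullback hY.polynomial_up).range ≤ (pullback hφb.polynomial_up).range := by
  rintro _ ⟨g, rfl⟩
  obtain ⟨-, ψ, hψ, hl, hri⟩ := hπ
  have hπ' : IsPolynomialMap π' := by
    have : IsPolynomialMap (π ∘ φ) := fun i => hY.polynomial_up.comp_mem (hY.polynomial_down i)
    rwa [hY.comp_eq] at this
  -- The integral equation holds in `Pol X'` and descends to `Pol Y` by injectivity.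
  have hg : (pullback hY.polynomial_down).toRingHom.IsIntegralElem g := by
    obtain ⟨p, hp, hpg⟩ := h'.isIntegralElem hπ' (pullback hY.polynomial_up g)
    refine ⟨p, hp, hY.injective_up ?_⟩
    have hc : (pullback hY.polynomial_up).toRingHom.comp (pullback hY.polynomial_down).toRingHom =
        (pullback hπ').toRingHom := RingHom.ext fun f => Subtype.ext <| funext fun z =>
      congrArg f.1 (congrFun hY.comp_eq z)
    rw [map_zero]
    refine Eq.trans ?_ hpg
    rw [← hc]
    exact Polynomial.hom_eval₂ p _ (pullback hY.polynomial_up).toRingHom g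
  obtain ⟨G, hG⟩ := h.exists_eq_of_isIntegralElem hY.polynomial_down hψ hri hg
  refine ⟨G, Subtype.ext <| funext fun z => ?_⟩
  refine (hG (φb z)).trans (congrArg g.1 ?_)
  rw [show πb (φb z) = π' z from congrFun hφb.comp_eq z, ← hY.comp_eq]
  exact hl _

end BiregularNormalization

end RealAlg

theorem mainTheorem1 {n : ℕ} (X : Set (Fin n → ℝ)) (hX : IsAlgebraicSet X) :
    -- the normalization and the biregular normalization exist as real algebraic sets
    (∃ (k : ℕ) (X' : Set (Fin k → ℝ)) (π' : X' → X), IsAlgebraicSet X' ∧ IsNormalization π') ∧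
    (∃ (m : ℕ) (Xb : Set (Fin m → ℝ)) (πb : Xb → X),
      IsAlgebraicSet Xb ∧ IsBiregularNormalization πb) ∧
    ∀ (m : ℕ) (Xb : Set (Fin m → ℝ)) (πb : Xb → X),
      IsAlgebraicSet Xb → IsBiregularNormalization πb →
      IsFiniteBirational πb ∧ IsBiregularIso πb ∧
      (∀ (l : ℕ) (Y : Set (Fin l → ℝ)) (π : Y → X), IsAlgebraicSet Y → IsFiniteBirational π →
        (IsBiregularIso π ↔ ∃ θ : Xb → Y, IsFiniteBirational θ ∧ π ∘ θ = πb)) ∧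
      -- `Xb` is the biggest intermediate set `Y` between `X` and `X'` with `Y → X` biregular
      (∀ (k : ℕ) (X' : Set (Fin k → ℝ)) (π' : X' → X), IsAlgebraicSet X' → IsNormalization π' →
        ∃ (φb : X' → Xb) (hφb : IsIntermediate π' φb πb), IsFiniteBirational φb ∧
          IsGreatest {B : Subalgebra ℝ (Pol X') | ∃ (l : ℕ) (Y : Set (Fin l → ℝ)) (φ : X' → Y)
              (π : Y → X) (h : IsIntermediate π' φ π),
              IsBiregularIso π ∧ B = (pullback h.polynomial_up).range}
            (pullback hφb.polynomial_up).range) := by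
  refine ⟨hX.exists_isNormalization, hX.exists_isBiregularNormalization,
    fun m Xb πb hXb h => ⟨h.isFiniteBirational hXb, h.isBiregularIso hXb,
      fun l Y π _ hπ => h.isBiregularIso_iff hXb hπ, fun k X' π' hX' h' => ?_⟩⟩
  obtain ⟨φb, hφb, hfin⟩ := h.exists_isIntermediate hXb hX' h'
  refine ⟨φb, hφb, hfin, ⟨m, Xb, φb, πb, hφb, h.isBiregularIso hXb, rfl⟩, ?_⟩
  rintro _ ⟨l, Y, φ, π, hY, hπ, rfl⟩
  exact h.range_pullback_le h' hφb hY hπ
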